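/- Give the unitary group $U(H)$ of a complex Hilbert space $H$ the strong operator topology (the topology of pointwise convergence on $H$). A topological group is called unitarily representable if it is isomorphic, as a topological group, to a topological subgroup of $U(H)$ for some (not necessarily separable) complex Hilbert space $H$. For a Tikhonov space $X$, the free topological group $F(X)$ is the free group on the set $X$ with the finest group topology for which the canonical map $X\to F(X)$ is continuous; equivalently, every continuous map from $X$ to a topological group extends uniquely to a continuous homomorphism on $F(X)$. **Proposition.** Let $P=\mathbb{R}\setminus\mathbb{Q}$ be the space of irrationals. If the free topological group $F(P)$ is unitarily representable, then for every Polish group $G$ there are a separable complex Hilbert space $H$ and a closed subgroup $N$ of $U(H)$ such that $G$ is isomorphic, as a topological group, to a quotient group of $N$ (with the quotient topology). -/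

import Mathlib

open Topology

universe u v

/-- The underlying group of the (Markov, non-pointed) free topological group `F(X)`:
the free group on the set `X`. -/
def FreeTopGroup (X : Type u) : Type u := FreeGroup X

namespace FreeTopGroup

instance instGroup (X : Type u) : Group (FreeTopGroup X) :=
  inferInstanceAs (Group (FreeGroup X))

/-- The canonical map `X → F(X)`. -/
def of {X : Type u} (x : X) : FreeTopGroup X := FreeGroup.of x

/-- The group homomorphism `F(X) → G` that extends a map `X → G`. -/
def lift {X : Type u} {G : Type v} [Group G] (f : X → G) : FreeTopGroup X →* G :=
  FreeGroup.lift f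

/-- The free group topology: the finest group topology for which the canonical map
`X → F(X)` is continuous. -/
def groupTopology (X : Type u) [TopologicalSpace X] : GroupTopology (FreeTopGroup X) :=
  GroupTopology.coinduced (of : X → FreeTopGroup X)

instance instTopologicalSpace (X : Type u) [TopologicalSpace X] :
    TopologicalSpace (FreeTopGroup X) :=
  (groupTopology X).toTopologicalSpace

instance instIsTopologicalGroup (X : Type u) [TopologicalSpace X] :
    IsTopologicalGroup (FreeTopGroup X) :=
  (groupTopology X).toIsTopologicalGroup

theorem lift_of {X : Type u} {G : Type v} [Group G] (f : X → G) (x : X) :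
    lift f (of x) = f x :=
  FreeGroup.lift_apply_of

theorem continuous_of {X : Type u} [TopologicalSpace X] :
    Continuous (of : X → FreeTopGroup X) :=
  GroupTopology.coinduced_continuous _

/-- The universal property: a continuous map from `X` to a topological group extends to a
continuous homomorphism on `F(X)`. -/
theorem continuous_lift {X : Type u} [TopologicalSpace X] {G : Type v} [Group G]
    [TopologicalSpace G] [IsTopologicalGroup G] {f : X → G} (hf : Continuous f) :
    Continuous (lift f) := by
  let T : GroupTopology (FreeTopGroup X) :=
    { TopologicalSpace.induced (lift f) inferInstance with
      toIsTopologicalGroup := topologicalGroup_induced (lift f) }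
  have hT : groupTopology X ≤ T := by
    refine sInf_le ?_
    change TopologicalSpace.coinduced of _ ≤ TopologicalSpace.induced (lift f) _
    rw [← continuous_iff_coinduced_le, continuous_induced_rng]
    have h : (lift f) ∘ of = f := funext (lift_of f)
    rw [h]
    exact hf
  exact continuous_iff_le_induced.2 hT

end FreeTopGroup

/-- The unitary group `U(H)` of a complex Hilbert space: the group of surjective linear
isometries of `H`. -/
def UnitaryGroup (H : Type u) [NormedAddCommGroup H] [InnerProductSpace ℂ H] : Type u :=
  H ≃ₗᵢ[ℂ] H

namespace UnitaryGroup

instance instGroup (H : Type u) [NormedAddCommGroup H] [InnerProductSpace ℂ H] :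
    Group (UnitaryGroup H) :=
  inferInstanceAs (Group (H ≃ₗᵢ[ℂ] H))

/-- A unitary operator as a map. -/
def toFun {H : Type u} [NormedAddCommGroup H] [InnerProductSpace ℂ H] (U : UnitaryGroup H) :
    H → H :=
  fun x => (show H ≃ₗᵢ[ℂ] H from U) x

/-- The strong operator topology: the topology inherited from the product `H ^ H`, in other words
the topology of pointwise convergence. -/
instance instTopologicalSpace (H : Type u) [NormedAddCommGroup H] [InnerProductSpace ℂ H] :
    TopologicalSpace (UnitaryGroup H) :=
  TopologicalSpace.induced toFun (Pi.topologicalSpace (ι := H) (Y := fun _ => H))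

end UnitaryGroup

/-- A topological group `G` is unitarily representable if it is isomorphic to a topological
subgroup of `U(H)`, with the strong operator topology, for some (possibly non-separable) complex
Hilbert space `H`; that is, if it has a homomorphism to `U(H)` that is a topological embedding. -/
def UnitarilyRepresentable (G : Type v) [Group G] [TopologicalSpace G] : Prop :=
  ∃ (H : Type u) (_ : NormedAddCommGroup H) (_ : InnerProductSpace ℂ H) (_ : CompleteSpace H)
    (f : G →* UnitaryGroup H), IsEmbedding f

/-- `G` is (isomorphic, as a topological group, to) a quotient of the topological group `N`. -/
def IsTopGroupQuotient (G : Type v) [Group G] [TopologicalSpace G] (N : Type u) [Group N]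
    [TopologicalSpace N] : Prop :=
  ∃ K : Subgroup N, ∃ _ : K.Normal, Nonempty ((N ⧸ K) ≃ₜ* G)

/-!
Every Polish group `G` is a quotient of the free topological group `F(P)` of the irrationals: there
is a continuous surjection `φ : P → G` that is open at one point and sends it to `1`
(`exists_continuous_irrational_open_at`), and this already makes the induced homomorphism
`q : F(P) → G` open (`FreeTopGroup.nhds_one_le_map_lift`). The map `φ` is pasted together from
continuous surjections onto open balls of `G`, which exist because continued fraction digits map the
irrational numbers above `1` continuously onto `ℕ → ℕ` (`exists_irrational_cfDigits_eq`).

If `F(P)` is a topological subgroup of `U(H)`, continuity of `q` at `1` involves only countably many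
vectors of `H`, since `G` is first countable. As `F(P)` is separable, those vectors generate a
separable subrepresentation `π`, and `q` is continuous and open for the topology that `π`
induces on `F(P)` (`exists_separable_rep`).

Finally `G`, being Polish, is Raikov complete (`exists_le_nhds_of_twoSided_cauchy`, by a Baire
category argument), so `q` extends to the closure `N` of the range of `π`. The extension is
continuous and surjective, and it is open because `q` is
(`isTopGroupQuotient_closure_range`). Hence `G` is a quotient of the closed subgroup `N`.
-/

open Filter Set

/-! ### Continued fraction digits of irrational numbers -/

/-- The continued fraction shift `x ↦ 1 / {x}`, on all of `ℝ`; on an integer it takes the junk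
value `0`, which is never met along the orbit of an irrational number. -/
noncomputable def gaussShift (x : ℝ) : ℝ := (Int.fract x)⁻¹

theorem irrational_gaussShift {x : ℝ} (hx : Irrational x) : Irrational (gaussShift x) := by
  rw [gaussShift, irrational_inv_iff, Int.fract]
  exact hx.sub_intCast _

theorem irrational_iterate_gaussShift {x : ℝ} (hx : Irrational x) (n : ℕ) :
    Irrational (gaussShift^[n] x) := by
  induction n with
  | zero => exact hx
  | succ n ih => rw [Function.iterate_succ_apply']; exact irrational_gaussShift ih

theorem continuousAt_gaussShift {x : ℝ} (hx : Irrational x) : ContinuousAt gaussShift x := by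
  refine (continuousAt_fract (hx.ne_int _)).inv₀ ?_
  exact (hx.sub_intCast ⌊x⌋).ne_zero

theorem continuousAt_iterate_gaussShift {x : ℝ} (hx : Irrational x) (n : ℕ) :
    ContinuousAt gaussShift^[n] x := by
  induction n with
  | zero => exact continuousAt_id
  | succ n ih =>
    rw [Function.iterate_succ']
    exact (continuousAt_gaussShift (irrational_iterate_gaussShift hx n)).comp ih

/-- The sequence of continued fraction digits of `x`, each lowered by `1`. For an irrational `x > 1`
every digit is at least `1`, so nothing is lost in truncating to `ℕ`, and every sequence of natural
numbers can occur. -/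
noncomputable def cfDigits (x : ℝ) (n : ℕ) : ℕ := (⌊gaussShift^[n] x⌋ - 1).toNat

theorem continuousAt_cfDigits {x : ℝ} (hx : Irrational x) : ContinuousAt cfDigits x := by
  refine continuousAt_pi.2 fun n => ?_
  have h := irrational_iterate_gaussShift hx n
  set y := gaussShift^[n] x with hy
  have hev : ∀ᶠ z in 𝓝 x, ⌊gaussShift^[n] z⌋ = ⌊y⌋ := by
    filter_upwards [continuousAt_iterate_gaussShift hx n
      (Ioo_mem_nhds ((Int.floor_le y).lt_of_ne (h.ne_int _).symm) (Int.lt_floor_add_one y))]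
      with z hz
    exact Int.floor_eq_iff.2 ⟨hz.1.le, hz.2⟩
  refine (continuousAt_const (y := cfDigits x n)).congr ?_
  filter_upwards [hev] with z hz
  simp only [cfDigits, hz, ← hy]

/-- An infinite continued fraction represents an irrational number: if `x n` had denominator `q`,
then `x (n + 1)` would have a strictly smaller one, because `0 < x n - a n < 1`. -/
theorem irrational_of_cf_expansion (a : ℕ → ℕ) (x : ℕ → ℝ)
    (hx : ∀ n, (a n : ℝ) < x n ∧ x n < a n + 1) (hr : ∀ n, x n = a n + (x (n + 1))⁻¹) :
    Irrational (x 0) := by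
  have key : ∀ (q : ℕ) (n : ℕ) (p : ℤ), 0 < q → x n * q ≠ p := by
    intro q
    induction q using Nat.strong_induction_on with
    | _ q ih =>
      intro n p hq h
      have hq' : (0 : ℝ) < q := by exact_mod_cast hq
      have h1 : (0 : ℝ) < x (n + 1) := lt_of_le_of_lt (Nat.cast_nonneg _) (hx (n + 1)).1
      have h2 : ((p - a n * q : ℤ) : ℝ) = (x n - a n) * q := by push_cast; rw [← h]; ring
      have h3 : 0 < p - a n * q := by
        have : (0 : ℝ) < ((p - a n * q : ℤ) : ℝ) := by
          rw [h2]; exact mul_pos (sub_pos.2 (hx n).1) hq'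
        exact_mod_cast this
      have h4 : p - a n * q < q := by
        have : ((p - a n * q : ℤ) : ℝ) < ((q : ℤ) : ℝ) := by
          rw [h2]; push_cast; nlinarith [(hx n).2]
        exact_mod_cast this
      obtain ⟨r, hr'⟩ := Int.eq_ofNat_of_zero_le h3.le
      rw [hr'] at h3 h4 h2
      refine ih r (by omega) (n + 1) q (by omega) ?_
      have h5 : (r : ℝ) = (x n - a n) * q := by simpa using h2
      rw [h5, hr n]
      field_simp
      simp
  rintro ⟨r, hr'⟩
  refine key r.den 0 r.num r.pos ?_
  rw [← hr']
  exact_mod_cast Rat.mul_den_eq_num r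

/-- Every sequence of positive integers is the sequence of digits of some infinite continued
fraction, whose complete quotients are the `x n`: the closed intervals of numbers with prescribed
first digits are compact and decreasing, so they have a common point. -/
theorem exists_cf_expansion (a : ℕ → ℕ) (ha : ∀ n, 1 ≤ a n) :
    ∃ x : ℕ → ℝ, (∀ n, (a n : ℝ) < x n ∧ x n < a n + 1) ∧ ∀ n, x n = a n + (x (n + 1))⁻¹ := by
  -- `J n k` is the set of numbers whose expansion may begin with `a k, …, a (k + n)`
  let J : ℕ → ℕ → Set ℝ := fun n => Nat.rec (fun k => Icc (a k) (a k + 1))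
    (fun _ J k => (fun y => (a k : ℝ) + y⁻¹) '' J (k + 1)) n
  have hJs : ∀ n k, J (n + 1) k = (fun y => (a k : ℝ) + y⁻¹) '' J n (k + 1) := fun n k => rfl
  have ha' : ∀ n, (1 : ℝ) ≤ a n := fun n => by exact_mod_cast ha n
  have hanti : ∀ n k, J (n + 1) k ⊆ J n k := by
    intro n
    induction n with
    | zero =>
      rintro k _ ⟨y, hy, rfl⟩
      have hy1 : 1 ≤ y := (ha' _).trans hy.1
      exact ⟨by simp; positivity, by simpa using inv_le_one_of_one_le₀ hy1⟩
    | succ n ih => intro k; rw [hJs (n + 1), hJs n]; exact image_mono (ih _)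
  have hA : ∀ k, Antitone fun n => J n k := fun k => antitone_nat_of_succ_le fun n => hanti n k
  have hJ1 : ∀ n k, ∀ y ∈ J n k, 1 ≤ y := fun n k y hy =>
    (ha' k).trans (hA k (Nat.zero_le n) hy).1
  have hc : ∀ n k, IsCompact (J n k) ∧ (J n k).Nonempty := by
    intro n
    induction n with
    | zero => exact fun k => ⟨isCompact_Icc, nonempty_Icc.2 (by simp)⟩
    | succ n ih =>
      refine fun k => ⟨(ih (k + 1)).1.image_of_continuousOn ?_, (ih (k + 1)).2.image _⟩
      refine continuousOn_const.add (continuousOn_id.inv₀ fun y hy => ?_)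
      exact (zero_lt_one.trans_le (hJ1 _ _ y hy)).ne'
  obtain ⟨x₀, hx₀⟩ : (⋂ n, J n 0).Nonempty :=
    IsCompact.nonempty_iInter_of_sequence_nonempty_isCompact_isClosed (fun n => J n 0)
      (fun n => hanti n 0) (fun n => (hc n 0).2) (hc 0 0).1 fun n => (hc n 0).1.isClosed
  let x : ℕ → ℝ := fun n => Nat.rec x₀ (fun k y => (y - a k)⁻¹) n
  have hxs : ∀ k, x (k + 1) = (x k - a k)⁻¹ := fun k => rfl
  have hxJ : ∀ k n, x k ∈ J n k := by
    intro k
    induction k with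
    | zero => exact mem_iInter.1 hx₀
    | succ k ih =>
      intro n
      obtain ⟨y, hy, hyx⟩ := hJs n k ▸ ih (n + 1)
      rw [hxs, ← hyx]
      simpa using hy
  have hr : ∀ n, x n = a n + (x (n + 1))⁻¹ := fun n => by rw [hxs]; simp
  have hlt : ∀ n, (a n : ℝ) < x n := fun n => by
    have : 0 < x (n + 1) := zero_lt_one.trans_le (hJ1 0 _ _ (hxJ (n + 1) 0))
    rw [hr n]
    simpa using this
  refine ⟨x, fun n => ⟨hlt n, ?_⟩, hr⟩
  rw [hr n]
  simpa using inv_lt_one_of_one_lt₀ ((ha' (n + 1)).trans_lt (hlt (n + 1)))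

theorem exists_irrational_cfDigits_eq (b : ℕ → ℕ) : ∃ x, Irrational x ∧ 1 < x ∧ cfDigits x = b := by
  obtain ⟨x, hx, hr⟩ := exists_cf_expansion (fun n => b n + 1) (fun n => by omega)
  have hfl : ∀ n, ⌊x n⌋ = b n + 1 := fun n =>
    Int.floor_eq_iff.2 ⟨by simpa using (hx n).1.le, by simpa using (hx n).2⟩
  have hit : ∀ n, gaussShift^[n] (x 0) = x n := by
    intro n
    induction n with
    | zero => rfl
    | succ n ih =>
      rw [Function.iterate_succ_apply', ih, gaussShift, Int.fract, hfl, inv_eq_iff_eq_inv,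
        sub_eq_iff_eq_add']
      simpa using hr n
  refine ⟨x 0, irrational_of_cf_expansion _ x hx hr, ?_, ?_⟩
  · have := (hx 0).1
    push_cast at this
    linarith [(Nat.cast_nonneg (b 0) : (0 : ℝ) ≤ b 0)]
  · ext n
    simp [cfDigits, hit, hfl]

/-! ### Raikov completeness and extension to the closure -/

/-- A completely metrizable topological group is Raikov complete: a filter that is Cauchy for both
the left and the right uniformity converges. By the Baire category theorem there is a point `x` such
that the translate `F * x` is Cauchy for a complete metric of `G`; that metric need not be
invariant. -/
theorem exists_le_nhds_of_twoSided_cauchy {G : Type*} [Group G] [TopologicalSpace G]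
    [IsTopologicalGroup G] [TopologicalSpace.IsCompletelyMetrizableSpace G]
    (F : Filter G) [F.NeBot]
    (hl : Tendsto (fun p : G × G => p.1⁻¹ * p.2) (F ×ˢ F) (𝓝 1))
    (hr : Tendsto (fun p : G × G => p.1 * p.2⁻¹) (F ×ˢ F) (𝓝 1)) :
    ∃ z, F ≤ 𝓝 z := by
  let _ := TopologicalSpace.upgradeIsCompletelyMetrizable G
  let W : ℕ → Set G := fun n =>
    interior {x | ∃ A ∈ F, ∀ y ∈ A, ∀ z ∈ A, dist (y * x) (z * x) < 1 / (n + 1)}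
  -- Given `x₀`, choose `a₀, a` deep in `F`. Then `a⁻¹ * a₀ * x₀` is near `x₀` because `F` is left
  -- Cauchy, and belongs to `W n` because `F` is right Cauchy.
  have hW : ∀ n, Dense (W n) := by
    intro n
    refine dense_iff_inter_open.2 fun O hO ⟨x₀, hx₀⟩ => ?_
    have hU : Tendsto (fun p : G × G => (p.1⁻¹ * p.2) * x₀) (F ×ˢ F) (𝓝 x₀) := by
      simpa using hl.mul_const x₀
    obtain ⟨A₀, hA₀, hA₀O⟩ := mem_prod_same_iff.1 (hU (hO.mem_nhds hx₀))
    obtain ⟨a₀, ha₀⟩ := Filter.nonempty_of_mem hA₀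
    have hδ : (0 : ℝ) < 1 / (n + 1) / 2 := by positivity
    -- neighbourhood of `1` whose products with points near `a₀ * x₀` stay in a small ball
    have hV : ∀ᶠ p : G × G in 𝓝 (1 : G) ×ˢ 𝓝 (a₀ * x₀),
        p.1 * p.2 ∈ Metric.ball (a₀ * x₀) (1 / (n + 1) / 2) := by
      have : Tendsto (fun p : G × G => p.1 * p.2) (𝓝 (1 : G) ×ˢ 𝓝 (a₀ * x₀))
          (𝓝 (a₀ * x₀)) := by
        have := tendsto_mul (M := G) (a := 1) (b := a₀ * x₀)
        rwa [one_mul, nhds_prod_eq] at this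
      exact this (Metric.ball_mem_nhds _ hδ)
    obtain ⟨V, hV1, Y, hY, hVY⟩ := mem_prod_iff.1 hV
    obtain ⟨A, hA, hAV⟩ := mem_prod_same_iff.1 (hr hV1)
    obtain ⟨a, ha, haA₀⟩ := Filter.nonempty_of_mem (inter_mem hA hA₀)
    refine ⟨a⁻¹ * a₀ * x₀, hA₀O (mk_mem_prod haA₀ ha₀), mem_interior_iff_mem_nhds.2 ?_⟩
    have hx : Tendsto (fun x : G => a * x) (𝓝 (a⁻¹ * a₀ * x₀)) (𝓝 (a₀ * x₀)) := by
      have := (continuous_const_mul a).tendsto (a⁻¹ * a₀ * x₀)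
      simpa [mul_assoc] using this
    filter_upwards [hx hY] with x hxY
    have key : ∀ y ∈ A, dist (y * x) (a₀ * x₀) < 1 / (n + 1) / 2 := by
      intro y hy
      have h := hVY (mk_mem_prod (hAV (mk_mem_prod hy ha)) hxY)
      simpa [mul_assoc] using h
    refine ⟨A, hA, fun y hy z hz => ?_⟩
    linarith [dist_triangle_right (y * x) (z * x) (a₀ * x₀), key y hy, key z hz]
  obtain ⟨x, hx⟩ := (dense_iInter_of_isOpen (fun n => isOpen_interior) hW).nonempty
  have hC : Cauchy (map (· * x) F) := by
    refine Metric.cauchy_iff.2 ⟨inferInstance, fun ε hε => ?_⟩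
    obtain ⟨n, hn⟩ := exists_nat_one_div_lt hε
    obtain ⟨A, hA, h⟩ := interior_subset (mem_iInter.1 hx n)
    refine ⟨_, image_mem_map hA, ?_⟩
    rintro _ ⟨y, hy, rfl⟩ _ ⟨z, hz, rfl⟩
    exact (h y hy z hz).trans hn
  obtain ⟨z, hz⟩ := CompleteSpace.complete hC
  have h : Tendsto (· * x) F (𝓝 z) := hz
  refine ⟨z * x⁻¹, ?_⟩
  simpa [Tendsto] using h.mul_const x⁻¹

/-- If the group topology on `A` pulled back from `U` along `π` is carried by `q` to the topology of
the Polish group `G`, then `q` extends to an open continuous surjective homomorphism from the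
closure of the range of `π` onto `G`. The value of the extension at `n` is the limit of `q a` as
`π a → n`, which exists by Raikov completeness of `G`. -/
theorem isTopGroupQuotient_closure_range {A : Type*} [Group A] {U : Type u} [Group U]
    [TopologicalSpace U] [IsTopologicalGroup U] {G : Type v} [Group G] [TopologicalSpace G]
    [IsTopologicalGroup G] [PolishSpace G] (π : A →* U) (q : A →* G)
    (hq : Function.Surjective q) (h : map q (comap π (𝓝 1)) = 𝓝 1) :
    IsTopGroupQuotient G π.range.topologicalClosure := by
  have hne : ∀ n : π.range.topologicalClosure, (comap π (𝓝 (n : U))).NeBot := by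
    intro n
    rw [comap_neBot_iff_frequently]
    refine (mem_closure_iff_frequently.1 n.2).mono ?_
    rintro _ ⟨a, rfl⟩
    exact ⟨a, rfl⟩
  have hlim : ∀ n : π.range.topologicalClosure,
      ∃ z, Tendsto q (comap π (𝓝 (n : U))) (𝓝 z) := by
    intro n
    have hq1 : Tendsto q (comap π (𝓝 1)) (𝓝 1) := h.le
    refine exists_le_nhds_of_twoSided_cauchy (map q (comap π (𝓝 (n : U)))) ?_ ?_
    · rw [prod_map_map_eq, tendsto_map'_iff]
      have : Tendsto (fun p : A × A => p.1⁻¹ * p.2)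
          (comap π (𝓝 (n : U)) ×ˢ comap π (𝓝 (n : U))) (comap π (𝓝 1)) := by
        rw [tendsto_comap_iff]
        have := ((tendsto_comap (f := π) (x := 𝓝 (n : U))).comp tendsto_fst).inv.mul
          ((tendsto_comap (f := π) (x := 𝓝 (n : U))).comp
            (tendsto_snd (f := comap π (𝓝 (n : U)))))
        simpa [Function.comp_def] using this
      simpa [Function.comp_def] using hq1.comp this
    · rw [prod_map_map_eq, tendsto_map'_iff]
      have : Tendsto (fun p : A × A => p.1 * p.2⁻¹)
          (comap π (𝓝 (n : U)) ×ˢ comap π (𝓝 (n : U))) (comap π (𝓝 1)) := by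
        rw [tendsto_comap_iff]
        have := ((tendsto_comap (f := π) (x := 𝓝 (n : U))).comp tendsto_fst).mul
          ((tendsto_comap (f := π) (x := 𝓝 (n : U))).comp
            (tendsto_snd (f := comap π (𝓝 (n : U))))).inv
        simpa [Function.comp_def] using this
      simpa [Function.comp_def] using hq1.comp this
  choose ψ hψ using hlim
  let Ψ : π.range.topologicalClosure →* G := MonoidHom.mk' ψ fun n m => by
    have hnm : Tendsto (fun p : A × A => p.1 * p.2)
        (comap π (𝓝 (n : U)) ×ˢ comap π (𝓝 (m : U))) (comap π (𝓝 ((n * m : _) : U))) := by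
      rw [tendsto_comap_iff]
      have := ((tendsto_comap (f := π) (x := 𝓝 (n : U))).comp tendsto_fst).mul
        ((tendsto_comap (f := π) (x := 𝓝 (m : U))).comp
          (tendsto_snd (f := comap π (𝓝 (n : U)))))
      simpa [Function.comp_def] using this
    have h1 := (hψ (n * m)).comp hnm
    have h2 := ((hψ n).comp tendsto_fst).mul
      ((hψ m).comp (tendsto_snd (f := comap π (𝓝 (n : U)))))
    refine tendsto_nhds_unique h1 (h2.congr fun p => ?_)
    simp
  -- `Ψ` extends `q`
  have hΨπ : ∀ (a : A) (ha : π a ∈ π.range.topologicalClosure), Ψ ⟨π a, ha⟩ = q a := by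
    intro a ha
    have : (pure a : Filter A) ≤ comap π (𝓝 (π a)) :=
      (map_le_iff_le_comap).1 (pure_le_nhds (π a))
    exact tendsto_nhds_unique (((hψ ⟨π a, ha⟩).mono_left this)) (tendsto_pure_nhds q a)
  have hsub : ∀ a, π a ∈ π.range.topologicalClosure := fun a =>
    π.range.le_topologicalClosure ⟨a, rfl⟩
  have hcont : Continuous Ψ := by
    refine continuous_of_continuousAt_one Ψ ?_
    rw [ContinuousAt, map_one]
    refine (closed_nhds_basis (1 : G)).tendsto_right_iff.2 fun V ⟨hV, hVc⟩ => ?_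
    obtain ⟨W, hW, hWV⟩ := mem_comap.1 (h.le hV : q ⁻¹' V ∈ comap π (𝓝 1))
    have : ∀ᶠ u in 𝓝 (1 : U), W ∈ 𝓝 u := eventually_mem_nhds_iff.2 hW
    filter_upwards [continuous_subtype_val.continuousAt (x := (1 : π.range.topologicalClosure)) this]
      with n hn
    refine hVc.mem_of_tendsto (hψ n) ?_
    filter_upwards [preimage_mem_comap hn] with a ha using hWV ha
  have hopen : IsOpenMap Ψ := by
    refine IsOpenMap.of_nhds_le fun n => ?_
    have h1 : 𝓝 (1 : G) ≤ map Ψ (𝓝 1) := by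
      rw [← h, nhds_subtype_eq_comap]
      intro S hS
      obtain ⟨W, hW, hWS⟩ := mem_comap.1 (mem_map.1 hS)
      refine mem_of_superset (image_mem_map (preimage_mem_comap hW)) ?_
      rintro _ ⟨a, ha, rfl⟩
      rw [← hΨπ a (hsub a)]
      exact hWS (show π a ∈ W from ha)
    rw [← map_mul_left_nhds_one n, ← map_mul_left_nhds_one (Ψ n), map_map]
    refine (map_mono h1).trans ?_
    rw [map_map]
    refine (congrArg (fun f => map f (𝓝 1)) ?_).le
    ext m
    simp
  have hsurj : Function.Surjective Ψ := fun g => by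
    obtain ⟨a, rfl⟩ := hq g
    exact ⟨⟨π a, hsub a⟩, hΨπ a _⟩
  let e := QuotientGroup.quotientKerEquivOfSurjective Ψ hsurj
  have he : ∀ n, e (QuotientGroup.mk n) = Ψ n := fun n => rfl
  have hec : Continuous e := QuotientGroup.isOpenQuotientMap_mk.isQuotientMap.continuous_iff.2 hcont
  have heo : IsOpenMap e := fun O hO => by
    have : e '' O = Ψ '' (QuotientGroup.mk ⁻¹' O) := by
      ext g
      constructor
      · rintro ⟨x, hx, rfl⟩
        obtain ⟨n, rfl⟩ := QuotientGroup.mk_surjective x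
        exact ⟨n, hx, rfl⟩
      · rintro ⟨n, hn, rfl⟩
        exact ⟨_, hn, rfl⟩
    rw [this]
    exact hopen _ (hO.preimage QuotientGroup.continuous_mk)
  exact ⟨Ψ.ker, inferInstance, ⟨
    { e with
      continuous_toFun := hec
      continuous_invFun := (e.toEquiv.toHomeomorphOfContinuousOpen hec heo).continuous_symm }⟩⟩

/-! ### Unitary groups with the strong operator topology -/

namespace UnitaryGroup

variable {H : Type*} [NormedAddCommGroup H] [InnerProductSpace ℂ H]

theorem mul_toFun (U V : UnitaryGroup H) (x : H) : (U * V).toFun x = U.toFun (V.toFun x) := rfl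

theorem one_toFun (x : H) : (1 : UnitaryGroup H).toFun x = x := rfl

theorem norm_toFun_sub (U : UnitaryGroup H) (x y : H) :
    ‖U.toFun x - U.toFun y‖ = ‖x - y‖ := by
  have := (show H ≃ₗᵢ[ℂ] H from U).dist_map x y
  rwa [dist_eq_norm, dist_eq_norm] at this

theorem inv_toFun_toFun (U : UnitaryGroup H) (x : H) : U⁻¹.toFun (U.toFun x) = x := by
  rw [← mul_toFun, inv_mul_cancel, one_toFun]

theorem toFun_inv_toFun (U : UnitaryGroup H) (x : H) : U.toFun (U⁻¹.toFun x) = x := by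
  rw [← mul_toFun, mul_inv_cancel, one_toFun]

theorem nhds_eq (U : UnitaryGroup H) : 𝓝 U = comap toFun (𝓝 U.toFun) := nhds_induced _ _

theorem continuous_toFun_apply (x : H) : Continuous fun U : UnitaryGroup H => U.toFun x :=
  (continuous_apply x).comp continuous_induced_dom

theorem continuous_iff {X : Type*} [TopologicalSpace X] {f : X → UnitaryGroup H} :
    Continuous f ↔ ∀ x, Continuous fun a => (f a).toFun x :=
  continuous_induced_rng.trans continuous_pi_iff

instance instIsTopologicalGroup : IsTopologicalGroup (UnitaryGroup H) where
  continuous_mul := continuous_iff.2 fun x => continuous_iff_continuousAt.2 fun ⟨U, V⟩ => by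
    -- `‖U' V' x - U V x‖ ≤ ‖V' x - V x‖ + ‖U' (V x) - U (V x)‖`
    refine tendsto_iff_norm_sub_tendsto_zero.2 ?_
    have h1 : Tendsto (fun p : UnitaryGroup H × UnitaryGroup H =>
        ‖p.2.toFun x - V.toFun x‖ + ‖p.1.toFun (V.toFun x) - U.toFun (V.toFun x)‖)
        (𝓝 (U, V)) (𝓝 0) := by
      have hc : Continuous fun p : UnitaryGroup H × UnitaryGroup H =>
          ‖p.2.toFun x - V.toFun x‖ + ‖p.1.toFun (V.toFun x) - U.toFun (V.toFun x)‖ :=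
        (((continuous_toFun_apply x).comp continuous_snd).sub continuous_const).norm.add
          (((continuous_toFun_apply (V.toFun x)).comp continuous_fst).sub continuous_const).norm
      have := hc.tendsto (U, V)
      simpa using this
    refine squeeze_zero (fun _ => norm_nonneg _) (fun p => ?_) h1
    rw [← norm_toFun_sub p.1 (p.2.toFun x)]
    exact norm_sub_le_norm_sub_add_norm_sub
      (p.1.toFun (p.2.toFun x)) (p.1.toFun (V.toFun x)) (U.toFun (V.toFun x))
  continuous_inv := continuous_iff.2 fun x => continuous_iff_continuousAt.2 fun U => by
    refine tendsto_iff_norm_sub_tendsto_zero.2 ?_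
    have h1 : Tendsto (fun V : UnitaryGroup H => ‖U.toFun (U⁻¹.toFun x) - V.toFun (U⁻¹.toFun x)‖)
        (𝓝 U) (𝓝 0) := by
      have := ((continuous_const (y := U.toFun (U⁻¹.toFun x))).sub
        (continuous_toFun_apply (U⁻¹.toFun x))).norm.tendsto U
      simpa using this
    refine h1.congr fun V => ?_
    change _ = ‖V⁻¹.toFun x - U⁻¹.toFun x‖
    rw [← norm_toFun_sub V (V⁻¹.toFun x), toFun_inv_toFun, toFun_inv_toFun]

end UnitaryGroup

/-! ### Restriction to a separable Hilbert space -/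

instance FreeTopGroup.separableSpace {X : Type*} [TopologicalSpace X]
    [TopologicalSpace.SeparableSpace X] : TopologicalSpace.SeparableSpace (FreeTopGroup X) := by
  obtain ⟨D, hDc, hD⟩ := TopologicalSpace.exists_countable_dense X
  have := hDc.to_subtype
  have : Countable (FreeGroup D) := by unfold FreeGroup; infer_instance
  let K : Subgroup (FreeTopGroup X) := (FreeGroup.lift fun d : D => of (d : X)).range
  have hK : (K : Set (FreeTopGroup X)).Countable := countable_range _
  refine ⟨K, hK, ?_⟩
  have hDK : of '' D ⊆ (K : Set (FreeTopGroup X)) := by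
    rintro _ ⟨d, hd, rfl⟩
    exact ⟨FreeGroup.of ⟨d, hd⟩, FreeGroup.lift_apply_of⟩
  have hgen : ∀ x : X, of x ∈ K.topologicalClosure := fun x =>
    closure_mono hDK (image_closure_subset_closure_image continuous_of ⟨x, hD x, rfl⟩)
  intro g
  refine FreeGroup.induction_on (C := fun g : FreeTopGroup X => g ∈ K.topologicalClosure) g
    (one_mem _) hgen (fun x h => inv_mem h) fun x y hx hy => mul_mem hx hy

/-- A separable Hilbert space in any universe has an isometric copy in `Type`: its Hilbert bases are
countable, so they can be indexed by a set of natural numbers. -/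
theorem exists_linearIsometryEquiv_lp (E : Type u) [NormedAddCommGroup E]
    [InnerProductSpace ℂ E] [CompleteSpace E] [TopologicalSpace.SeparableSpace E] :
    ∃ ι : Type, Nonempty (E ≃ₗᵢ[ℂ] lp (fun _ : ι => ℂ) 2) := by
  obtain ⟨w, b, hb⟩ := exists_hilbertBasis ℂ E
  have hw : Countable w := by
    -- distinct basis vectors are at distance at least `1`
    have hd : ∀ i j : w, i ≠ j → 1 ≤ dist i j := fun i j hij => by
      have h0 : inner ℂ (i : E) (j : E) = 0 := by simpa [hb] using b.orthonormal.2 hij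
      have hi : ‖(i : E)‖ = 1 := by simpa [hb] using b.orthonormal.1 i
      have hj : ‖(j : E)‖ = 1 := by simpa [hb] using b.orthonormal.1 j
      have := norm_sub_sq (𝕜 := ℂ) (i : E) (j : E)
      rw [h0, hi, hj] at this
      rw [Subtype.dist_eq, dist_eq_norm]
      simp only [map_zero] at this
      nlinarith [norm_nonneg ((i : E) - j)]
    have := UniformSpace.secondCountable_of_separable E
    have := DiscreteTopology.of_forall_le_dist zero_lt_one hd
    exact TopologicalSpace.separableSpace_iff_countable.1 inferInstance
  obtain ⟨f, hf⟩ := exists_injective_nat w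
  let e := Equiv.ofInjective f hf
  refine ⟨range f, ⟨(HilbertBasis.mk (v := b ∘ e.symm)
    (b.orthonormal.comp _ e.symm.injective) ?_).repr⟩⟩
  rw [e.symm.surjective.range_comp, b.dense_span]

namespace UnitaryGroup

/-- The restriction of a unitary representation to an invariant subspace `M`, transported along
an isometry of `M` onto `K`. -/
noncomputable def subrep {A : Type*} [Group A] {H : Type*} [NormedAddCommGroup H]
    [InnerProductSpace ℂ H] {K : Type*} [NormedAddCommGroup K] [InnerProductSpace ℂ K]
    (f : A →* UnitaryGroup H) (M : Submodule ℂ H) (hM : ∀ a, ∀ x ∈ M, (f a).toFun x ∈ M)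
    (W : M ≃ₗᵢ[ℂ] K) : A →* UnitaryGroup K :=
  let r : A → (M ≃ₗᵢ[ℂ] M) := fun a =>
    { toFun := fun x => ⟨(f a).toFun x, hM a x x.2⟩
      invFun := fun x => ⟨(f a⁻¹).toFun x, hM a⁻¹ x x.2⟩
      left_inv := fun x => Subtype.ext (by simp [map_inv, inv_toFun_toFun])
      right_inv := fun x => Subtype.ext (by simp [map_inv, toFun_inv_toFun])
      map_add' := fun x y =>
        Subtype.ext (map_add (show H ≃ₗᵢ[ℂ] H from f a) (x : H) (y : H))
      map_smul' := fun c x =>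
        Subtype.ext (map_smul (show H ≃ₗᵢ[ℂ] H from f a) c (x : H))
      norm_map' := fun x => (show H ≃ₗᵢ[ℂ] H from f a).norm_map x }
  MonoidHom.mk' (fun a => (W.symm.trans (r a)).trans W) fun a b => by
    refine LinearIsometryEquiv.ext fun x => ?_
    change W ⟨_, _⟩ = W ⟨_, _⟩
    refine congrArg W (Subtype.ext ?_)
    simp only [map_mul, mul_toFun]
    change _ = (f a).toFun (W.symm (W ⟨(f b).toFun (W.symm x), _⟩) : M)
    rw [W.symm_apply_apply]
    rfl

theorem subrep_toFun {A : Type*} [Group A] {H : Type*} [NormedAddCommGroup H]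
    [InnerProductSpace ℂ H] {K : Type*} [NormedAddCommGroup K] [InnerProductSpace ℂ K]
    (f : A →* UnitaryGroup H) (M : Submodule ℂ H) (hM : ∀ a, ∀ x ∈ M, (f a).toFun x ∈ M)
    (W : M ≃ₗᵢ[ℂ] K) (a : A) (x : M) :
    (subrep f M hM W a).toFun (W x) = W ⟨(f a).toFun x, hM a x x.2⟩ := by
  change W ⟨(f a).toFun (W.symm (W x) : M), _⟩ = _
  simp only [W.symm_apply_apply]

end UnitaryGroup

open UnitaryGroup in
/-- Let a separable group `A` be a topological subgroup of a unitary group, and let `q` be a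
continuous homomorphism from `A` to a first countable group. Some representation of `A` on a
separable Hilbert space induces a topology on `A` that is coarser than the given one but for which
`q` is still continuous. The space is generated by the orbits of countably many vectors that witness
the continuity of `q` at `1`. -/
theorem exists_separable_rep {A : Type*} [Group A] [TopologicalSpace A]
    [TopologicalSpace.SeparableSpace A] {H : Type u} [NormedAddCommGroup H]
    [InnerProductSpace ℂ H] [CompleteSpace H] (f : A →* UnitaryGroup H) (hf : IsEmbedding f)
    {G : Type*} [Group G] [TopologicalSpace G] [FirstCountableTopology G]
    (q : A →* G) (hq : Continuous q) :
    ∃ (K : Type) (_ : NormedAddCommGroup K) (_ : InnerProductSpace ℂ K) (_ : CompleteSpace K)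
      (_ : TopologicalSpace.SeparableSpace K) (π : A →* UnitaryGroup K),
      Continuous π ∧ Tendsto q (comap π (𝓝 1)) (𝓝 1) := by
  have horb : ∀ x, Continuous fun a => (f a).toFun x := continuous_iff.1 hf.continuous
  -- continuity of `q` at `1` is witnessed by countably many vectors `S`
  obtain ⟨V, hV⟩ := (𝓝 (1 : G)).exists_antitone_basis
  have hS : ∀ n, ∃ (I : Set H) (t : H → Set H), I.Finite ∧ (∀ x, t x ∈ 𝓝 x) ∧
      ∀ a, (∀ x ∈ I, (f a).toFun x ∈ t x) → q a ∈ V n := by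
    intro n
    have h1 : q ⁻¹' V n ∈ 𝓝 (1 : A) := hq.continuousAt (by simpa using hV.mem n)
    rw [hf.nhds_eq_comap, map_one, UnitaryGroup.nhds_eq, comap_comap, nhds_pi] at h1
    obtain ⟨T, hT, hTV⟩ := mem_comap.1 h1
    obtain ⟨I, hI, t, ht, htT⟩ := mem_pi.1 hT
    exact ⟨I, t, hI, ht, fun a ha => hTV (htT ha)⟩
  choose I t hI ht hIt using hS
  let S : Set H := ⋃ n, I n
  have hSc : S.Countable := countable_iUnion fun n => (hI n).countable
  let O : Set H := ⋃ x ∈ S, range fun a => (f a).toFun x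
  let M : Submodule ℂ H := (Submodule.span ℂ O).topologicalClosure
  have hO : TopologicalSpace.IsSeparable O := by
    have := hSc.to_subtype
    simp only [O, biUnion_eq_iUnion]
    exact .iUnion fun x => TopologicalSpace.isSeparable_range (horb _)
  have hMsep : TopologicalSpace.SeparableSpace M := hO.span.closure.separableSpace
  have hM : ∀ a, ∀ x ∈ M, (f a).toFun x ∈ M := by
    intro a
    let L : H ≃ₗᵢ[ℂ] H := f a
    have h1 : (Submodule.span ℂ O) ≤ (Submodule.span ℂ O).comap L.toLinearEquiv.toLinearMap := by
      refine Submodule.span_le.2 fun y hy => Submodule.subset_span ?_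
      obtain ⟨x, hx, b, rfl⟩ := mem_iUnion₂.1 hy
      refine mem_iUnion₂.2 ⟨x, hx, a * b, ?_⟩
      simp only [map_mul, mul_toFun]
      rfl
    intro x hx
    exact map_mem_closure L.continuous hx h1
  have hSM : ∀ x ∈ S, x ∈ M := fun x hx => Submodule.le_topologicalClosure _
    (Submodule.subset_span (mem_iUnion₂.2 ⟨x, hx, 1, by simp [one_toFun]⟩))
  have : CompleteSpace M := (Submodule.isClosed_topologicalClosure _).completeSpace_coe
  obtain ⟨ι, ⟨W⟩⟩ := exists_linearIsometryEquiv_lp M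
  let π := subrep f M hM W
  refine ⟨lp (fun _ : ι => ℂ) 2, inferInstance, inferInstance, inferInstance,
    W.surjective.denseRange.separableSpace W.continuous, π, ?_, ?_⟩
  · refine continuous_iff.2 fun y => ?_
    obtain ⟨x, rfl⟩ := W.surjective y
    simp only [π, subrep_toFun]
    exact W.continuous.comp ((horb x).subtype_mk _)
  · refine hV.1.tendsto_right_iff.2 fun n _ => ?_
    have h2 : ∀ x ∈ I n, ∀ᶠ a in comap π (𝓝 1), (f a).toFun x ∈ t n x := by
      intro x hx
      have hxM := hSM x (mem_iUnion.2 ⟨n, hx⟩)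
      have hc : Continuous fun u : UnitaryGroup (lp (fun _ : ι => ℂ) 2) =>
          ((W.symm (u.toFun (W ⟨x, hxM⟩)) : M) : H) :=
        continuous_subtype_val.comp (W.symm.continuous.comp (continuous_toFun_apply _))
      have h1 := (hc.tendsto 1).comp (tendsto_comap (f := π))
      rw [one_toFun, W.symm_apply_apply] at h1
      filter_upwards [h1 (ht n x)] with a ha
      simpa [π, subrep_toFun] using ha
    filter_upwards [(hI n).eventually_all.2 h2] with a ha using hIt n a ha

/-! ### Continuous surjections from the irrationals onto Polish spaces -/

/-- The irrational numbers in an interval with rational endpoints can be mapped continuously onto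
any nonempty Polish space. -/
theorem exists_continuousAt_irrational_surjOn_Ioo {p r : ℚ} (hpr : p < r) (X : Type*)
    [TopologicalSpace X] [PolishSpace X] [Nonempty X] :
    ∃ f : ℝ → X, (∀ x, Irrational x → x ∈ Ioo (p : ℝ) r → ContinuousAt f x) ∧
      ∀ y, ∃ x, Irrational x ∧ x ∈ Ioo (p : ℝ) r ∧ f x = y := by
  obtain ⟨h, hc, hs⟩ := PolishSpace.exists_nat_nat_continuous_surjective X
  have hpr' : (p : ℝ) < r := by exact_mod_cast hpr
  -- `x ↦ (r - p) / (x - p)` maps `(p, r)` onto `(1, ∞)` and preserves irrationality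
  refine ⟨fun x => h (cfDigits (((r - p : ℚ) : ℝ) / (x - p))), fun x hx hxI => ?_, fun y => ?_⟩
  · have hi : Irrational (((r - p : ℚ) : ℝ) / (x - p)) :=
      (hx.sub_ratCast p).ratCast_div (sub_pos.2 hpr).ne'
    have h1 : ContinuousAt (fun x : ℝ => ((r - p : ℚ) : ℝ) / (x - p)) x :=
      continuousAt_const.div (continuousAt_id.sub continuousAt_const) (sub_pos.2 hxI.1).ne'
    exact hc.continuousAt.comp (f := fun x : ℝ => cfDigits (((r - p : ℚ) : ℝ) / (x - p)))
      (ContinuousAt.comp (f := fun x : ℝ => ((r - p : ℚ) : ℝ) / (x - p))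
        (continuousAt_cfDigits hi) h1)
  · obtain ⟨b, rfl⟩ := hs y
    obtain ⟨z, hz, hz1, rfl⟩ := exists_irrational_cfDigits_eq b
    have hz0 : 0 < z := zero_lt_one.trans hz1
    have hd : 0 < (r : ℝ) - p := sub_pos.2 hpr'
    refine ⟨p + ((r - p : ℚ) : ℝ) / z, (hz.ratCast_div (sub_pos.2 hpr).ne').ratCast_add p,
      ⟨?_, ?_⟩, ?_⟩
    · push_cast
      have := div_pos hd hz0
      linarith
    · push_cast
      have := div_lt_self hd hz1
      linarith
    · have : ((r - p : ℚ) : ℝ) / (p + ((r - p : ℚ) : ℝ) / z - p) = z := by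
        rw [add_sub_cancel_left, div_div_cancel₀]
        exact_mod_cast (sub_pos.2 hpr).ne'
      simp only [this]

/-- The irrational numbers can be mapped continuously onto a Polish space `G` so that the map is open
at one point `x₀`, which is sent to a prescribed point `e`. Intervals `(a n, a (n + 1))` that
converge to `x₀` are mapped onto the members of a neighbourhood basis of `e`, and the rest is
sent to `e`. -/
theorem exists_continuous_irrational_open_at (G : Type*) [TopologicalSpace G] [PolishSpace G]
    (e : G) :
    ∃ (f : {x : ℝ // Irrational x} → G) (x₀ : {x : ℝ // Irrational x}), Continuous f ∧
      Function.Surjective f ∧ f x₀ = e ∧ ∀ V ∈ 𝓝 x₀, f '' V ∈ 𝓝 e := by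
  let _ := TopologicalSpace.upgradeIsCompletelyMetrizable G
  let x₀ : {x : ℝ // Irrational x} := ⟨√2, irrational_sqrt_two⟩
  obtain ⟨a, ham, hax, hal⟩ :=
    Rat.isDenseEmbedding_coe_real.dense.exists_seq_strictMono_tendsto Rat.cast_mono (√2)
  have hlt : ∀ n, (a n : ℝ) < √2 := fun n => hax n
  have ham' : StrictMono fun n => (a n : ℝ) := Rat.cast_strictMono.comp ham
  -- a decreasing basis of open neighbourhoods of `e`, starting with the whole space
  let B : ℕ → Set G := fun n => {y | n * dist y e < 1}
  have hBo : ∀ n, IsOpen (B n) := fun n =>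
    isOpen_lt (continuous_const.mul (continuous_id.dist continuous_const)) continuous_const
  have heB : ∀ n, e ∈ B n := fun n => by simp [B]
  have hpiece : ∀ n, ∃ f : ℝ → G, (∀ x, Irrational x → x ∈ Ioo (a n : ℝ) (a (n + 1)) →
      ContinuousAt f x) ∧ (∀ x, f x ∈ B n) ∧
      ∀ y ∈ B n, ∃ x, Irrational x ∧ x ∈ Ioo (a n : ℝ) (a (n + 1)) ∧ f x = y := by
    intro n
    have := (hBo n).polishSpace
    have : Nonempty (B n) := ⟨⟨e, heB n⟩⟩
    obtain ⟨f, hfc, hfs⟩ := exists_continuousAt_irrational_surjOn_Ioo (ham n.lt_succ_self) (B n)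
    refine ⟨fun x => f x, fun x hx hxI => continuous_subtype_val.continuousAt.comp (hfc x hx hxI),
      fun x => (f x).2, fun y hy => ?_⟩
    obtain ⟨x, hx, hxI, hxy⟩ := hfs ⟨y, hy⟩
    exact ⟨x, hx, hxI, congrArg Subtype.val hxy⟩
  choose g hgc hgB hgs using hpiece
  have huniq : ∀ {m n : ℕ} {x : ℝ}, x ∈ Ioo (a m : ℝ) (a (m + 1)) → x ∈ Ioo (a n : ℝ) (a (n + 1)) →
      m = n := by
    have : ∀ {m n : ℕ} {x : ℝ}, x ∈ Ioo (a m : ℝ) (a (m + 1)) →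
        x ∈ Ioo (a n : ℝ) (a (n + 1)) → ¬ m < n := by
      intro m n x hm hn hmn
      have : (a (m + 1) : ℝ) ≤ a n := ham'.monotone hmn
      linarith [hm.2, hn.1]
    intro m n x hm hn
    exact le_antisymm (not_lt.1 (this hn hm)) (not_lt.1 (this hm hn))
  classical
  let F : ℝ → G := fun x => if h : ∃ n, x ∈ Ioo (a n : ℝ) (a (n + 1)) then g h.choose x else e
  have hF : ∀ n x, x ∈ Ioo (a n : ℝ) (a (n + 1)) → F x = g n x := by
    intro n x hx
    have h : ∃ n, x ∈ Ioo (a n : ℝ) (a (n + 1)) := ⟨n, hx⟩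
    simp only [F, dif_pos h]
    rw [huniq h.choose_spec hx]
  have hF' : ∀ x, (∀ n, x ∉ Ioo (a n : ℝ) (a (n + 1))) → F x = e := fun x hx =>
    dif_neg (not_exists.2 hx)
  -- far enough along the sequence `a`, the values of `F` lie in `B n`
  have hFB : ∀ n x, (a n : ℝ) < x → F x ∈ B n := by
    intro n x hx
    by_cases h : ∃ m, x ∈ Ioo (a m : ℝ) (a (m + 1))
    · obtain ⟨m, hm⟩ := h
      rw [hF m x hm]
      have hnm : n ≤ m := by
        by_contra! hmn
        have : (a (m + 1) : ℝ) ≤ a n := ham'.monotone hmn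
        linarith [hm.2]
      have h1 : (m : ℝ) * dist (g m x) e < 1 := hgB m x
      have h2 : (n : ℝ) * dist (g m x) e ≤ m * dist (g m x) e := by gcongr
      exact h2.trans_lt h1
    · rw [hF' x (not_exists.1 h)]
      exact heB n
  have hFx₀ : F (√2) = e := hF' _ fun n h => (hlt (n + 1)).not_gt h.2
  have hcont : ∀ x, Irrational x → ContinuousAt F x := by
    intro x hx
    rcases lt_trichotomy x (√2) with h | rfl | h
    · by_cases h0 : x < a 0
      · refine (continuousAt_const (y := e)).congr ?_
        filter_upwards [Iio_mem_nhds h0] with z hz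
        refine (hF' z fun n hn => ?_).symm
        have : (a 0 : ℝ) ≤ a n := ham'.monotone n.zero_le
        exact absurd hn.1 (by have := mem_Iio.1 hz; linarith)
      · have hex : ∃ n, x < a n := (hal.eventually_const_lt h).exists
        obtain ⟨n, hn⟩ : ∃ n, Nat.find hex = n + 1 := Nat.exists_eq_succ_of_ne_zero fun h1 =>
          h0 (h1 ▸ Nat.find_spec hex)
        have hxI : x ∈ Ioo (a n : ℝ) (a (n + 1)) :=
          ⟨(not_lt.1 (Nat.find_min hex (by omega))).lt_of_ne (hx.ne_rat _).symm,
            hn ▸ Nat.find_spec hex⟩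
        refine (hgc n x hx hxI).congr ?_
        filter_upwards [Ioo_mem_nhds hxI.1 hxI.2] with z hz using (hF n z hz).symm
    · -- at `x₀`, use that `B n` shrinks to `e`
      rw [ContinuousAt, hFx₀]
      refine Metric.tendsto_nhds.2 fun ε hε => ?_
      obtain ⟨n, hn⟩ := exists_nat_gt (1 / ε)
      filter_upwards [Ioi_mem_nhds (hlt n)] with x hx
      have h1 : (n : ℝ) * dist (F x) e < 1 := hFB n x hx
      by_contra! h2
      have h3 : 1 < n * ε := by rwa [div_lt_iff₀ hε] at hn
      have h4 : (n : ℝ) * ε ≤ n * dist (F x) e := by gcongr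
      linarith
    · refine (continuousAt_const (y := e)).congr ?_
      filter_upwards [Ioi_mem_nhds h] with z hz
      exact (hF' z fun n hn => absurd hn.2 (by have := mem_Ioi.1 hz; linarith [hlt (n + 1)])).symm
  refine ⟨fun x => F x, x₀, continuous_iff_continuousAt.2 fun x =>
    (hcont x x.2).comp continuous_subtype_val.continuousAt, fun y => ?_, hFx₀, fun V hV => ?_⟩
  · obtain ⟨x, hx, hxI, rfl⟩ := hgs 0 y (by simp [B])
    exact ⟨⟨x, hx⟩, hF 0 x hxI⟩
  · obtain ⟨T, hT, hTV⟩ := mem_nhds_subtype _ _ _ |>.1 hV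
    obtain ⟨l, hl, hlT⟩ := exists_Ioc_subset_of_mem_nhds hT (exists_lt _)
    obtain ⟨n, hn⟩ := (hal.eventually_const_lt hl).exists
    refine mem_of_superset ((hBo n).mem_nhds (heB n)) fun y hy => ?_
    obtain ⟨x, hx, hxI, rfl⟩ := hgs n y hy
    exact ⟨⟨x, hx⟩, hTV (hlT ⟨hn.trans hxI.1, (hxI.2.trans (hlt _)).le⟩), hF n x hxI⟩

/-! ### Polish groups as quotients of closed unitary groups -/

/-- The extension of `f` to the free topological group is open as soon as `f` is open at a single
point that it sends to `1`: a neighbourhood of `1` contains `(of x₀)⁻¹ * of x` for all `x` near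
`x₀`. -/
theorem FreeTopGroup.nhds_one_le_map_lift {X : Type*} [TopologicalSpace X] {G : Type*} [Group G]
    [TopologicalSpace G] [IsTopologicalGroup G] {f : X → G} {x₀ : X} (h1 : f x₀ = 1)
    (hf : ∀ V ∈ 𝓝 x₀, f '' V ∈ 𝓝 (1 : G)) :
    𝓝 1 ≤ map (lift f) (𝓝 1) := by
  intro S hS
  have hc : Tendsto (fun x : X => (of x₀)⁻¹ * of x) (𝓝 x₀) (𝓝 1) := by
    have : Continuous fun x : X => (of x₀)⁻¹ * of x := continuous_const.mul continuous_of
    simpa using this.tendsto x₀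
  refine mem_of_superset (hf _ (hc hS)) ?_
  rintro _ ⟨x, hx, rfl⟩
  have : lift f ((of x₀)⁻¹ * of x) ∈ S := hx
  simpa [lift_of, h1] using this

theorem mainTheorem4
    (hP : UnitarilyRepresentable.{u} (FreeTopGroup {x : ℝ // Irrational x}))
    (G : Type v) [Group G] [TopologicalSpace G] [IsTopologicalGroup G] [PolishSpace G] :
    ∃ (H : Type) (_ : NormedAddCommGroup H) (_ : InnerProductSpace ℂ H) (_ : CompleteSpace H)
      (_ : TopologicalSpace.SeparableSpace H) (N : Subgroup (UnitaryGroup H)),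
      IsClosed (N : Set (UnitaryGroup H)) ∧ IsTopGroupQuotient G N := by
  obtain ⟨H, _, _, _, f, hf⟩ := hP
  obtain ⟨φ, x₀, hφ, hφs, hφ1, hφo⟩ := exists_continuous_irrational_open_at G 1
  let q := FreeTopGroup.lift φ
  have hqs : Function.Surjective q := fun y => by
    obtain ⟨x, rfl⟩ := hφs y
    exact ⟨FreeTopGroup.of x, FreeTopGroup.lift_of φ x⟩
  obtain ⟨K, iK, iK', iK'', iK''', π, hπ, hq⟩ :=
    exists_separable_rep f hf q (FreeTopGroup.continuous_lift hφ)
  refine ⟨K, iK, iK', iK'', iK''', π.range.topologicalClosure,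
    π.range.isClosed_topologicalClosure, isTopGroupQuotient_closure_range π q hqs ?_⟩
  refine le_antisymm hq ((FreeTopGroup.nhds_one_le_map_lift hφ1 hφo).trans (map_mono ?_))
  have := hπ.tendsto 1
  rw [map_one] at this
  exact this.le_comap
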